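/- Setting. For $n\in\mathbb N$ let $B_n=\{0,1\}^n$; for $X=(x_0,\dots,x_{n-1})\in B_n$ put $|X|=\sum_i x_i$ and $a_X=|X|/n$ (the Boolean mean). A quantum algorithm with $T$ queries for inputs in $B_n$ acts on $\lceil\log_2 n\rceil+1+w$ qubits (for some $w\ge 0$) with computational basis states $|i,b,z\rangle$, where $i$ is an index of $\lceil\log_2 n\rceil$ bits, $b$ is one bit and $z$ consists of $w$ bits. On input $X$ it prepares the state $\psi_X=U_TQ_XU_{T-1}Q_X\cdots U_1Q_XU_0\psi_0$, where the unit vector $\psi_0$ and the unitary maps $U_0,\dots,U_T$ do not depend on $X$, and $Q_X|i,b,z\rangle=|i,b\oplus x_i,z\rangle$ if $i<n$, $Q_X|i,b,z\rangle=|i,b,z\rangle$ otherwise. Then $\psi_X$ is measured by a quantum measurement with finitely many outcomes $j$ and measurement operators $M_j$, $\sum_jM_j^\dagger M_j=1$, so that outcome $j$ occurs with probability $p_X(j)=\|M_j\psi_X\|^2$; on outcome $j$ the algorithm returns a real number $\hat a(j)$. The operators $M_j$ and the numbers $\hat a(j)$ do not depend on $X$ either. For $p\in(\tfrac12,1]$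 the error on input $X$ and the average probabilistic error with respect to a probability measure $\mu$ on $B_n$ are $$e(X,T,p)=\inf\Big\{\gamma:\sum_{j:\,|a_X-\hat a(j)|\le\gamma}p_X(j)\ge p\Big\},\qquad e^{\mathrm{avg}}(B_n,T,p)=\sum_{X\in B_n}e(X,T,p)\,\mu(X).$$ Theorem 3.1. Let $p\in(\tfrac12,1]$, $c>0$ and $\theta>0$. There is a constant $C>0$, depending only on $p$, $c$ and $\theta$, such that the following holds. For every $n$ let $I_n\subseteq\{0,\dots,n\}$ be a set of consecutive indices, $\mu_n$ a probability measure on $B_n$, and $\varepsilon_n>0$, such that - $|I_n|\to\infty$ as $n\to\infty$; - for all sufficiently large $n$, $k(n-k)\ge\theta n^2$ for every $k\in I_n$ (that is, $k(n-k)=\Theta(n^2)$ on $I_n$); - for all sufficiently large $n$, $\mu_n(X)\ge c\,|I_n|^{-1}\binom{n}{|X|}^{-1}$ for every $X\in B_n$ with $|X|\in I_n$; - $\varepsilon_n=o(|I_n|/n)$. Then for all sufficiently large $n$, every quantum algorithm for inputs in $B_n$ whose average probabilistic error with respect to $\mu_n$ satisfies $e^{\mathrm{avg}}(B_n,T,p)\le\varepsilon_n$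 makes $T\ge C\min(\varepsilon_n^{-1},n)$ queries. That is, $T=\Omega(\min(\varepsilon_n^{-1},n))$. -/

import Mathlib

open Filter Topology MeasureTheory Asymptotics

namespace BooleanMean

noncomputable section

/-- The class of inputs: all tuples of `n` Boolean variables. -/
abbrev Input (n : ℕ) : Type := Fin n → Bool

/-- The number `|X|` of ones of `X`. -/
def ones {n : ℕ} (X : Input n) : ℕ := (Finset.univ.filter fun i => X i = true).card

/-- The Boolean mean `a_X = |X| / n`. -/
def mean {n : ℕ} (X : Input n) : ℝ := (ones X : ℝ) / n

/-- Labels `(i, b, z)` of the computational basis states of `m = ⌈log₂ n⌉ + 1 + w` qubits: an index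
register of `⌈log₂ n⌉` qubits, one answer qubit, and `w` work qubits. -/
abbrev Label (n w : ℕ) : Type := (Fin (Nat.clog 2 n) → Bool) × Bool × (Fin w → Bool)

/-- The state space `ℂ² ⊗ ⋯ ⊗ ℂ²` of these qubits, in coordinates of the computational basis. -/
abbrev QubitSpace (n w : ℕ) : Type := EuclideanSpace ℂ (Label n w)

/-- The bit `x_i` that the oracle holds at the address written in binary in the index register
(addresses `0, …, n - 1`); it is `0` for a bit string that is no address. -/
def oracleBit {n : ℕ} (X : Input n) (i : Fin (Nat.clog 2 n) → Bool) : Bool :=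
  if h : Nat.ofBits i < n then X ⟨Nat.ofBits i, h⟩ else false

/-- The permutation `(i, b, z) ↦ (i, b ⊕ x_i, z)` of the basis labels. -/
def queryPerm {n : ℕ} (X : Input n) (w : ℕ) : Equiv.Perm (Label n w) :=
  Function.Involutive.toPerm
    (fun s => (s.1, Bool.xor s.2.1 (oracleBit X s.1), s.2.2))
    (by rintro ⟨i, b, z⟩; simp)

/-- The query `Q_X`: the unitary map with `|i, b, z⟩ ↦ |i, b ⊕ x_i, z⟩`. -/
def query {n : ℕ} (X : Input n) (w : ℕ) : QubitSpace n w ≃ₗᵢ[ℂ] QubitSpace n w :=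
  LinearIsometryEquiv.piLpCongrLeft 2 ℂ ℂ (queryPerm X w)

/-- A quantum algorithm with `T` queries for inputs of length `n`. None of the data depends on the
input. The final measurement is a general quantum measurement with finitely many outcomes, given by
its measurement operators `M_j` with `∑ j, M_j† M_j = 1` (a measurement in the computational
basis and a projective measurement are special cases). From the outcome `j` the
algorithm returns the real number `estimate j`. -/
structure QuantumAlgorithm (n T : ℕ) where
  /-- the number of work qubits -/
  work : ℕ
  /-- the initial state -/
  init : QubitSpace n work
  norm_init : ‖init‖ = 1
  /-- the unitary transformations `U_0, …, U_T` -/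
  U : Fin (T + 1) → (QubitSpace n work ≃ₗᵢ[ℂ] QubitSpace n work)
  /-- the number of outcomes of the measurement -/
  outcomes : ℕ
  /-- the measurement operators -/
  measOp : Fin outcomes → (QubitSpace n work →L[ℂ] QubitSpace n work)
  sum_measOp : ∑ j, (ContinuousLinearMap.adjoint (measOp j)).comp (measOp j) = 1
  /-- the approximation of the mean returned for each outcome -/
  estimate : Fin outcomes → ℝ

namespace QuantumAlgorithm

variable {n T : ℕ} (A : QuantumAlgorithm n T) (X : Input n)

/-- The state `U_t Q_X U_{t-1} ⋯ U_1 Q_X U_0 |ψ₀⟩` after `t` queries. -/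
def state (t : Fin (T + 1)) : QubitSpace n A.work :=
  Fin.induction (motive := fun _ => QubitSpace n A.work) (A.U 0 A.init)
    (fun s v => A.U s.succ (query X A.work v)) t

/-- The final state `U_T Q_X U_{T-1} Q_X ⋯ U_1 Q_X U_0 |ψ₀⟩`. -/
def finalState : QubitSpace n A.work := A.state X (Fin.last T)

/-- The probability `p_X(j) = ‖M_j ψ‖²` of the outcome `j` on input `X`. -/
def prob (j : Fin A.outcomes) : ℝ := ‖A.measOp j (A.finalState X)‖ ^ 2

/-- The error on input `X`: the infimum of all `γ` such that the estimate is within `γ` of the mean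
`a_X` with probability at least `p`. -/
def err (p : ℝ) : ℝ :=
  sInf {γ : ℝ | p ≤ ∑ j ∈ Finset.univ.filter (fun j => |mean X - A.estimate j| ≤ γ), A.prob X j}

/-- The average probabilistic error with respect to the measure `μ` on the inputs. -/
def avgErr (p : ℝ) (μ : Measure (Input n)) : ℝ := ∑ X : Input n, A.err X p * μ.real {X}

end QuantumAlgorithm

end

end BooleanMean

namespace BooleanMean

section

open Finset

/-! This is an adversary argument over all pairs `S ⊆ R` with `#S = k`, `#R = k + d`, where `d` is
of order `⌈ε n⌉`. The two inputs differ only on `Z = R \ S`, and a query separates their states only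
through the amplitude that they carry at addresses in `Z`. As `Z` runs over the `d`-subsets of `Sᶜ`
(or of `R`), a unit state puts on average at most `d / (n - k)` (or `d / (k + d)`) of its squared
norm there. All states start equal, so the mean squared distance after `T` queries is `O(T d / n)`
when `k (n - k) ≥ θ n²` (`progress_le`). Conversely, the means differ by `d / n`. If the two errors
add up to less, the outputs distinguish the inputs and the final states are at a constant distance.
`progress_last_ge` turns this into a bound on the mean, and `exists_add_le_four_mul` finds two
levels `k`, `k + d` in `I` whose errors are small on average. Hence `T d / n` is bounded below by a
positive constant. -/

/-- The input whose ones are the elements of `S`. -/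
def inputOf {n : ℕ} (S : Finset (Fin n)) : Input n := fun i => decide (i ∈ S)

theorem ones_inputOf {n : ℕ} (S : Finset (Fin n)) : ones (inputOf S) = S.card := by
  simp [ones, inputOf]

theorem inputOf_bijective {n : ℕ} :
    Function.Bijective (inputOf : Finset (Fin n) → Input n) := by
  refine ⟨fun S S' h => ?_, fun X => ⟨univ.filter fun i => X i = true, ?_⟩⟩
  · ext i
    simpa [inputOf] using congrFun h i
  · ext i
    simp [inputOf]

/-! ### Separation of two states by one query -/

theorem query_apply {n w : ℕ} (X : Input n) (v : QubitSpace n w) (s : Label n w) :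
    query X w v s = v (queryPerm X w s) := rfl

theorem queryPerm_apply_of_eq {n w : ℕ} {X Y : Input n} {s : Label n w}
    (h : oracleBit X s.1 = oracleBit Y s.1) : queryPerm X w s = queryPerm Y w s := by
  change (s.1, Bool.xor s.2.1 (oracleBit X s.1), s.2.2) = _
  rw [h]
  rfl

/-- The squared norm of the part of `v` on which the queries of `X` and `Y` differ. -/
noncomputable def diffMass {n w : ℕ} (X Y : Input n) (v : QubitSpace n w) : ℝ :=
  ∑ s : Label n w, if oracleBit X s.1 = oracleBit Y s.1 then 0 else ‖v s‖ ^ 2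

/-- Where the oracle bits agree, both queries permute coordinates identically, so the distance is
unchanged; elsewhere `‖u - v‖² ≤ 2‖u‖² + 2‖v‖²`. The bound is linear in the masses, with no square
root, which is what lets it be averaged over pairs. -/
theorem norm_query_sub_query_sq_le {n w : ℕ} (X Y : Input n) (a b : QubitSpace n w) :
    ‖query X w a - query Y w b‖ ^ 2 ≤
      ‖a - b‖ ^ 2 + 2 * (diffMass X Y a + diffMass X Y b) := by
  have h1 : ‖a - b‖ ^ 2 = ∑ s, ‖a (queryPerm X w s) - b (queryPerm X w s)‖ ^ 2 := by
    rw [EuclideanSpace.norm_sq_eq]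
    exact (Equiv.sum_comp (queryPerm X w) fun s => ‖a s - b s‖ ^ 2).symm
  have h2 : diffMass X Y a = ∑ s : Label n w,
      if oracleBit X s.1 = oracleBit Y s.1 then 0 else ‖a (queryPerm X w s)‖ ^ 2 :=
    (Equiv.sum_comp (queryPerm X w) fun s : Label n w =>
      if oracleBit X s.1 = oracleBit Y s.1 then 0 else ‖a s‖ ^ 2).symm
  -- Queries preserve the address, so the region of disagreement is invariant and each mass may be
  -- reindexed by its own permutation.
  have h3 : diffMass X Y b = ∑ s : Label n w,
      if oracleBit X s.1 = oracleBit Y s.1 then 0 else ‖b (queryPerm Y w s)‖ ^ 2 :=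
    (Equiv.sum_comp (queryPerm Y w) fun s : Label n w =>
      if oracleBit X s.1 = oracleBit Y s.1 then 0 else ‖b s‖ ^ 2).symm
  rw [h1, h2, h3, ← sum_add_distrib, mul_sum, ← sum_add_distrib, EuclideanSpace.norm_sq_eq]
  refine sum_le_sum fun s _ => ?_
  rw [PiLp.sub_apply, query_apply, query_apply]
  split_ifs with h
  · rw [queryPerm_apply_of_eq h]
    simp
  · have := norm_sub_le (a (queryPerm X w s)) (b (queryPerm Y w s))
    have h0 := norm_nonneg (a (queryPerm X w s) - b (queryPerm Y w s))
    nlinarith [sq_nonneg (‖a (queryPerm X w s)‖ - ‖b (queryPerm Y w s)‖),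
      sq_nonneg ‖a (queryPerm X w s) - b (queryPerm X w s)‖]

/-- The squared norm of the part of `v` with address `i`. -/
noncomputable def addressMass {n w : ℕ} (v : QubitSpace n w) (i : Fin n) : ℝ :=
  ∑ s : Label n w, if Nat.ofBits s.1 = i then ‖v s‖ ^ 2 else 0

theorem sum_addressMass_le {n w : ℕ} (v : QubitSpace n w) (S : Finset (Fin n)) :
    ∑ i ∈ S, addressMass v i ≤ ‖v‖ ^ 2 := by
  unfold addressMass
  rw [sum_comm, EuclideanSpace.norm_sq_eq]
  refine sum_le_sum fun s _ => ?_
  by_cases h : ∃ i ∈ S, Nat.ofBits s.1 = (i : ℕ)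
  · obtain ⟨i, hi, h⟩ := h
    rw [sum_eq_single_of_mem i hi, if_pos h]
    intro j _ hj
    rw [if_neg]
    intro h'
    exact hj (Fin.ext (h'.symm.trans h))
  · push Not at h
    rw [sum_eq_zero fun i hi => if_neg (h i hi)]
    positivity

theorem diffMass_le {n w : ℕ} {S R Z : Finset (Fin n)} (hR : ∀ i, i ∉ Z → (i ∈ S ↔ i ∈ R))
    (v : QubitSpace n w) :
    diffMass (inputOf S) (inputOf R) v ≤ ∑ i ∈ Z, addressMass v i := by
  unfold addressMass diffMass
  rw [sum_comm]
  refine sum_le_sum fun s _ => ?_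
  have hnn : ∀ i ∈ Z, (0 : ℝ) ≤ if Nat.ofBits s.1 = (i : ℕ) then ‖v s‖ ^ 2 else 0 :=
    fun i _ => by split_ifs <;> positivity
  split_ifs with h
  · exact sum_nonneg hnn
  · by_cases hn : Nat.ofBits s.1 < n
    · by_cases hZ : (⟨Nat.ofBits s.1, hn⟩ : Fin n) ∈ Z
      · refine le_trans (by simp) (single_le_sum hnn hZ)
      · refine absurd ?_ h
        simp [oracleBit, hn, inputOf, hR _ hZ]
    · exact absurd (by simp [oracleBit, hn]) h

/-! ### Double counting of subsets -/

/-- Each element of `V` lies in the fraction `d / #V` of the subsets of `V` with `d` elements. -/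
theorem card_mul_sum_powersetCard_sum {α : Type*} [DecidableEq α] (V : Finset α) (d : ℕ)
    (f : α → ℝ) :
    (V.card : ℝ) * ∑ Z ∈ V.powersetCard d, ∑ i ∈ Z, f i =
      d * (V.card.choose d) * ∑ i ∈ V, f i := by
  rcases Nat.eq_zero_or_pos d with rfl | hd
  · simp
  obtain ⟨e, rfl⟩ : ∃ e, d = e + 1 := ⟨d - 1, by omega⟩
  have key : ∀ i ∈ V, ((V.powersetCard (e + 1)).filter fun Z => i ∈ Z).card =
      (V.card - 1).choose e := by
    intro i hi
    rw [← card_erase_of_mem hi, ← card_powersetCard]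
    refine card_bij' (fun Z _ => Z.erase i) (fun Z _ => insert i Z) ?_ ?_ ?_ ?_
    · intro Z hZ
      simp only [mem_filter, mem_powersetCard] at hZ ⊢
      exact ⟨erase_subset_erase i hZ.1.1, by rw [card_erase_of_mem hZ.2, hZ.1.2]; rfl⟩
    · intro Z hZ
      simp only [mem_filter, mem_powersetCard] at hZ ⊢
      have hiZ : i ∉ Z := fun h => notMem_erase i V (hZ.1 h)
      exact ⟨⟨insert_subset hi (hZ.1.trans (erase_subset i V)),
        by rw [card_insert_of_notMem hiZ, hZ.2]⟩, mem_insert_self i Z⟩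
    · intro Z hZ
      exact insert_erase (mem_filter.1 hZ).2
    · intro Z hZ
      exact erase_insert fun h => notMem_erase i V ((mem_powersetCard.1 hZ).1 h)
  have h1 : ∑ Z ∈ V.powersetCard (e + 1), ∑ i ∈ Z, f i =
      ∑ i ∈ V, ((V.card - 1).choose e : ℝ) * f i := by
    rw [sum_comm' (t' := V) (s' := fun i => (V.powersetCard (e + 1)).filter fun Z => i ∈ Z)]
    · refine sum_congr rfl fun i hi => ?_
      rw [sum_const, key i hi, nsmul_eq_mul]
    · intro Z i
      simp only [mem_filter, mem_powersetCard]
      exact ⟨fun h => ⟨h, h.1.1 h.2⟩, fun h => h.1⟩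
  rw [h1, ← mul_sum, ← mul_assoc]
  rcases V.eq_empty_or_nonempty with rfl | hV
  · simp
  obtain ⟨m, hm⟩ : ∃ m, V.card = m + 1 := ⟨V.card - 1, by have := hV.card_pos; omega⟩
  rw [hm, Nat.add_sub_cancel]
  congr 1
  have := Nat.add_one_mul_choose_eq m e
  have : ((m + 1 : ℕ) : ℝ) * (m.choose e) = ((m + 1).choose (e + 1)) * (e + 1 : ℕ) := by
    exact_mod_cast this
  rw [this, mul_comm]

/-- Two ways to list the pairs `S ⊆ R` with `#S = k` and `#R = k + d`. -/
theorem sum_powersetCard_compl_comm {α : Type*} [Fintype α] [DecidableEq α] (k d : ℕ)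
    (F : Finset α → Finset α → Finset α → ℝ) :
    ∑ S ∈ univ.powersetCard k, ∑ Z ∈ Sᶜ.powersetCard d, F S Z (S ∪ Z) =
      ∑ R ∈ univ.powersetCard (k + d), ∑ Z ∈ R.powersetCard d, F (R \ Z) Z R := by
  rw [sum_sigma', sum_sigma']
  refine sum_bij' (fun x _ => ⟨x.1 ∪ x.2, x.2⟩) (fun x _ => ⟨x.1 \ x.2, x.2⟩) ?_ ?_ ?_ ?_ ?_
  · rintro ⟨S, Z⟩ h
    simp only [mem_sigma, mem_powersetCard, subset_univ, true_and] at h ⊢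
    have hd : Disjoint S Z := disjoint_left.2 fun i hi hZ => mem_compl.1 (h.2.1 hZ) hi
    exact ⟨by rw [card_union_of_disjoint hd, h.1, h.2.2], subset_union_right, h.2.2⟩
  · rintro ⟨R, Z⟩ h
    simp only [mem_sigma, mem_powersetCard, subset_univ, true_and] at h ⊢
    refine ⟨by rw [card_sdiff_of_subset h.2.1, h.1, h.2.2]; omega, fun i hi => ?_, h.2.2⟩
    simp [hi]
  · rintro ⟨S, Z⟩ h
    simp only [mem_sigma, mem_powersetCard, subset_univ, true_and] at h ⊢
    have hd : Disjoint S Z := disjoint_left.2 fun i hi hZ => mem_compl.1 (h.2.1 hZ) hi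
    simp [union_sdiff_cancel_right hd]
  · rintro ⟨R, Z⟩ h
    simp only [mem_sigma, mem_powersetCard, subset_univ, true_and] at h ⊢
    simp [sdiff_union_of_subset h.2.1]
  · rintro ⟨S, Z⟩ h
    simp only [mem_sigma, mem_powersetCard, subset_univ, true_and] at h ⊢
    have hd : Disjoint S Z := disjoint_left.2 fun i hi hZ => mem_compl.1 (h.2.1 hZ) hi
    simp [union_sdiff_cancel_right hd]

/-! ### Growth of the distance with the number of queries -/

namespace QuantumAlgorithm

variable {n T : ℕ} (A : QuantumAlgorithm n T) (X Y : Input n)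

theorem state_zero : A.state X 0 = A.U 0 A.init := rfl

theorem state_succ (t : Fin T) :
    A.state X t.succ = A.U t.succ (query X A.work (A.state X t.castSucc)) := rfl

theorem norm_state (t : Fin (T + 1)) : ‖A.state X t‖ = 1 := by
  induction t using Fin.induction with
  | zero => rw [state_zero, LinearIsometryEquiv.norm_map, A.norm_init]
  | succ t ih => rw [state_succ, LinearIsometryEquiv.norm_map, LinearIsometryEquiv.norm_map, ih]

theorem norm_state_sub_sq_succ_le (t : Fin T) :
    ‖A.state X t.succ - A.state Y t.succ‖ ^ 2 ≤
      ‖A.state X t.castSucc - A.state Y t.castSucc‖ ^ 2 +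
        2 * (diffMass X Y (A.state X t.castSucc) + diffMass X Y (A.state Y t.castSucc)) := by
  rw [state_succ, state_succ, ← map_sub, LinearIsometryEquiv.norm_map]
  exact norm_query_sub_query_sq_le X Y _ _

/-- The sum of the squared distances of the states for all pairs `S ⊆ R` with `#S = k` and
`#R = k + d`. -/
noncomputable def progress (k d : ℕ) (t : Fin (T + 1)) : ℝ :=
  ∑ S ∈ univ.powersetCard k, ∑ Z ∈ Sᶜ.powersetCard d,
    ‖A.state (inputOf S) t - A.state (inputOf (S ∪ Z)) t‖ ^ 2

/-- The number of pairs `S ⊆ R ⊆ {0, …, n - 1}` with `#S = k` and `#R = k + d`. -/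
def pairCount (n k d : ℕ) : ℕ := n.choose k * (n - k).choose d

/-- The same pairs counted from the larger set; needed to average over the states of `R`. -/
theorem pairCount_eq {n k d : ℕ} :
    pairCount n k d = n.choose (k + d) * (k + d).choose d := by
  have h := Nat.choose_mul (n := n) (Nat.le_add_right k d)
  rw [Nat.add_sub_cancel_left, Nat.choose_symm_add] at h
  exact h.symm

theorem sum_sum_powersetCard_le (m d : ℕ) (𝒮 : Finset (Finset (Fin n)))
    (V : Finset (Fin n) → Finset (Fin n)) (hm : 0 < m) (hV : ∀ S ∈ 𝒮, (V S).card = m)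
    (t : Fin (T + 1)) :
    ∑ S ∈ 𝒮, ∑ Z ∈ (V S).powersetCard d, ∑ i ∈ Z, addressMass (A.state (inputOf S) t) i ≤
      (𝒮.card * m.choose d : ℕ) * ((d : ℝ) / m) := by
  have hm' : (0 : ℝ) < m := by exact_mod_cast hm
  have : ∀ S ∈ 𝒮, ∑ Z ∈ (V S).powersetCard d, ∑ i ∈ Z,
      addressMass (A.state (inputOf S) t) i ≤ m.choose d * ((d : ℝ) / m) := by
    intro S hS
    have h := card_mul_sum_powersetCard_sum (V S) d (addressMass (A.state (inputOf S) t))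
    have h1 := sum_addressMass_le (A.state (inputOf S) t) (V S)
    rw [norm_state, one_pow] at h1
    rw [hV S hS] at h
    rw [← mul_div_assoc, le_div_iff₀ hm', mul_comm _ (m : ℝ), h, mul_comm (d : ℝ)]
    exact mul_le_of_le_one_right (by positivity) h1
  refine (sum_le_sum this).trans_eq ?_
  rw [sum_const, nsmul_eq_mul]
  push_cast
  ring

theorem progress_succ_le {k d : ℕ} (hk : k < n) (hkd : 0 < k + d) (t : Fin T) :
    A.progress k d t.succ ≤ A.progress k d t.castSucc +
      2 * pairCount n k d * ((d : ℝ) / (n - k : ℕ) + d / (k + d : ℕ)) := by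
  have h1 := A.sum_sum_powersetCard_le (n - k) d (univ.powersetCard k) (fun S => Sᶜ)
    (by omega) (fun S hS => by rw [card_compl, (mem_powersetCard.1 hS).2, Fintype.card_fin])
    t.castSucc
  have h2 := A.sum_sum_powersetCard_le (k + d) d (univ.powersetCard (k + d)) (fun S => S)
    (by omega) (fun S hS => (mem_powersetCard.1 hS).2) t.castSucc
  rw [← sum_powersetCard_compl_comm k d fun _ Z R => ∑ i ∈ Z,
    addressMass (A.state (inputOf R) t.castSucc) i] at h2
  rw [card_powersetCard, card_univ, Fintype.card_fin] at h1 h2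
  rw [← pairCount_eq] at h2
  change _ ≤ (pairCount n k d : ℝ) * _ at h1
  have h3 : A.progress k d t.succ ≤ A.progress k d t.castSucc +
      2 * (∑ S ∈ univ.powersetCard k, ∑ Z ∈ Sᶜ.powersetCard d, ∑ i ∈ Z,
          addressMass (A.state (inputOf S) t.castSucc) i +
        ∑ S ∈ univ.powersetCard k, ∑ Z ∈ Sᶜ.powersetCard d, ∑ i ∈ Z,
          addressMass (A.state (inputOf (S ∪ Z)) t.castSucc) i) := by
    unfold progress
    rw [← sum_add_distrib, mul_sum, ← sum_add_distrib]
    refine sum_le_sum fun S _ => ?_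
    rw [← sum_add_distrib, mul_sum, ← sum_add_distrib]
    refine sum_le_sum fun Z _ => ?_
    have hZ : ∀ i, i ∉ Z → (i ∈ S ↔ i ∈ S ∪ Z) := fun i hi => by simp [hi]
    have := A.norm_state_sub_sq_succ_le (inputOf S) (inputOf (S ∪ Z)) t
    have := diffMass_le hZ (A.state (inputOf S) t.castSucc)
    have := diffMass_le hZ (A.state (inputOf (S ∪ Z)) t.castSucc)
    linarith
  linarith

theorem progress_le {k d : ℕ} (hk : k < n) (hkd : 0 < k + d) (t : Fin (T + 1)) :
    A.progress k d t ≤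
      t * (2 * pairCount n k d * ((d : ℝ) / (n - k : ℕ) + d / (k + d : ℕ))) := by
  induction t using Fin.induction with
  | zero => simp [progress, state_zero]
  | succ t ih =>
    have := A.progress_succ_le hk hkd t
    rw [Fin.val_castSucc] at ih
    rw [Fin.val_succ]
    push_cast at *
    linarith

/-! ### Accurate outputs force distant states -/

theorem sum_norm_measOp_sq (v : QubitSpace n A.work) :
    ∑ j, ‖A.measOp j v‖ ^ 2 = ‖v‖ ^ 2 := by
  have h := congrArg (fun L : QubitSpace n A.work →L[ℂ] QubitSpace n A.work =>
    RCLike.re (inner ℂ (L v) v)) A.sum_measOp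
  simp only [_root_.sum_apply, ContinuousLinearMap.comp_apply, sum_inner, map_sum,
    ContinuousLinearMap.adjoint_inner_left, one_apply_eq_self] at h
  simpa only [inner_self_eq_norm_sq] using h

theorem sum_prob : ∑ j, A.prob X j = 1 := by
  unfold prob
  rw [sum_norm_measOp_sq, finalState, norm_state, one_pow]

theorem prob_nonneg (j : Fin A.outcomes) : 0 ≤ A.prob X j := sq_nonneg _

/-- Factor `‖M u‖² - ‖M v‖²` as a difference of squares, bound the difference by `‖M (u - v)‖`, and
apply Cauchy–Schwarz to each of the two resulting sums. -/
theorem sum_prob_sub_le (J : Finset (Fin A.outcomes)) :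
    ∑ j ∈ J, A.prob X j - ∑ j ∈ J, A.prob Y j ≤ 2 * ‖A.finalState X - A.finalState Y‖ := by
  set D := ‖A.finalState X - A.finalState Y‖ with hD
  have hD0 : 0 ≤ D := norm_nonneg _
  have hsq : ∑ j, ‖A.measOp j (A.finalState X - A.finalState Y)‖ ^ 2 = D ^ 2 :=
    A.sum_norm_measOp_sq _
  have hcs : ∀ W, (∑ j ∈ J, ‖A.measOp j (A.finalState X - A.finalState Y)‖ *
      ‖A.measOp j (A.finalState W)‖) ≤ D := by
    intro W
    have h1 := sum_mul_sq_le_sq_mul_sq J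
      (fun j => ‖A.measOp j (A.finalState X - A.finalState Y)‖)
      (fun j => ‖A.measOp j (A.finalState W)‖)
    have h2 : ∑ j ∈ J, ‖A.measOp j (A.finalState X - A.finalState Y)‖ ^ 2 ≤ D ^ 2 :=
      hsq ▸ sum_le_univ_sum_of_nonneg fun j => sq_nonneg _
    have h3 : ∑ j ∈ J, ‖A.measOp j (A.finalState W)‖ ^ 2 ≤ 1 :=
      A.sum_prob W ▸ sum_le_univ_sum_of_nonneg fun j => sq_nonneg _
    have h4 : 0 ≤ ∑ j ∈ J, ‖A.measOp j (A.finalState W)‖ ^ 2 :=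
      sum_nonneg fun j _ => sq_nonneg _
    refine le_of_sq_le_sq ?_ hD0
    nlinarith [sq_nonneg D]
  rw [← sum_sub_distrib, two_mul]
  refine le_trans ?_ (add_le_add (hcs X) (hcs Y))
  rw [← sum_add_distrib]
  refine sum_le_sum fun j _ => ?_
  unfold prob
  rw [← mul_add, map_sub]
  have h1 := norm_sub_norm_le (A.measOp j (A.finalState X)) (A.measOp j (A.finalState Y))
  nlinarith [norm_nonneg (A.measOp j (A.finalState X)), norm_nonneg (A.measOp j (A.finalState Y))]

theorem err_nonneg {p : ℝ} (hp : 0 < p) : 0 ≤ A.err X p := by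
  refine Real.sInf_nonneg fun γ hγ => ?_
  by_contra! h
  -- A negative radius admits no outcome, and the empty sum is below `p`.
  have : (univ.filter fun j => |mean X - A.estimate j| ≤ γ) = ∅ :=
    filter_eq_empty_iff.2 fun j _ hj => by linarith [abs_nonneg (mean X - A.estimate j)]
  simp only [Set.mem_ofPred_eq, this, sum_empty] at hγ
  linarith

theorem exists_of_err_lt {p e : ℝ} (hp1 : p ≤ 1) (he : A.err X p < e) :
    ∃ γ < e, p ≤ ∑ j ∈ univ.filter (fun j => |mean X - A.estimate j| ≤ γ), A.prob X j := by
  have hne : {γ : ℝ | p ≤ ∑ j ∈ univ.filter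
      (fun j => |mean X - A.estimate j| ≤ γ), A.prob X j}.Nonempty := by
    refine ⟨∑ j, |mean X - A.estimate j|, ?_⟩
    rw [Set.mem_ofPred_eq, filter_true_of_mem, sum_prob]
    · exact hp1
    · exact fun j _ => single_le_sum (f := fun j => |mean X - A.estimate j|)
        (fun j _ => abs_nonneg _) (mem_univ j)
  obtain ⟨γ, hγ, h⟩ := exists_lt_of_csInf_lt hne he
  exact ⟨γ, h, hγ⟩

/-- States of inputs whose means differ by more than the sum of the errors are far apart. -/
theorem le_norm_finalState_sub {p : ℝ} (hp1 : p ≤ 1)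
    (h : A.err X p + A.err Y p < |mean X - mean Y|) :
    2 * p - 1 ≤ 2 * ‖A.finalState X - A.finalState Y‖ := by
  obtain ⟨γ, hγ, hX⟩ := A.exists_of_err_lt X hp1 (lt_sub_iff_add_lt.2 h)
  obtain ⟨δ, hδ, hY⟩ := A.exists_of_err_lt Y hp1 (lt_sub_comm.1 hγ)
  refine le_trans ?_ (A.sum_prob_sub_le X Y (univ.filter fun j => |mean X - A.estimate j| ≤ γ))
  -- Since `γ + δ < |mean X - mean Y|`, no estimate serves both inputs; so on `Y` the outcomes good
  -- for `X` have probability at most `1 - p`.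
  have hdisj : Disjoint (univ.filter fun j => |mean X - A.estimate j| ≤ γ)
      (univ.filter fun j => |mean Y - A.estimate j| ≤ δ) := by
    refine disjoint_left.2 fun j h1 h2 => ?_
    simp only [mem_filter, mem_univ, true_and] at h1 h2
    have := abs_sub_le (mean X) (A.estimate j) (mean Y)
    rw [abs_sub_comm (A.estimate j)] at this
    linarith
  have := sum_le_univ_sum_of_nonneg (s := (univ.filter fun j => |mean X - A.estimate j| ≤ γ) ∪
    (univ.filter fun j => |mean Y - A.estimate j| ≤ δ)) (A.prob_nonneg Y)
  rw [sum_union hdisj, sum_prob] at this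
  linarith

/-- A linear minorant of the threshold statement: it is trivial when the errors are too large, so it
holds for every pair and can be averaged without discarding bad inputs. -/
theorem le_norm_finalState_sub_sq {p : ℝ} (hp : 1 / 2 < p) (hp1 : p ≤ 1)
    (h : mean X ≠ mean Y) :
    (2 * p - 1) ^ 2 / 4 * (1 - (A.err X p + A.err Y p) * |mean X - mean Y|⁻¹) ≤
      ‖A.finalState X - A.finalState Y‖ ^ 2 := by
  have h0 : 0 < |mean X - mean Y| := abs_pos.2 (sub_ne_zero.2 h)
  have h1 := add_nonneg (A.err_nonneg X (p := p) (by linarith))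
    (A.err_nonneg Y (p := p) (by linarith))
  have hq : 0 ≤ (2 * p - 1) ^ 2 / 4 := by positivity
  by_cases hlt : A.err X p + A.err Y p < |mean X - mean Y|
  · have h2 := A.le_norm_finalState_sub X Y hp1 hlt
    have h3 : ((2 * p - 1) / 2) ^ 2 ≤ ‖A.finalState X - A.finalState Y‖ ^ 2 :=
      pow_le_pow_left₀ (by linarith) (by linarith) 2
    refine (mul_le_of_le_one_right hq ?_).trans (le_of_eq_of_le (by ring) h3)
    exact sub_le_self _ (mul_nonneg h1 (inv_nonneg.2 h0.le))
  · refine (mul_nonpos_of_nonneg_of_nonpos hq ?_).trans (sq_nonneg _)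
    rw [← div_eq_mul_inv, sub_nonpos, le_div_iff₀ h0, one_mul]
    exact not_lt.1 hlt

/-! ### Averages over levels -/

theorem mean_sub_mean_union {S Z : Finset (Fin n)} (h : Disjoint S Z) :
    |mean (inputOf S) - mean (inputOf (S ∪ Z))| = (Z.card : ℝ) / n := by
  rw [mean, mean, ones_inputOf, ones_inputOf, card_union_of_disjoint h, ← sub_div, Nat.cast_add,
    sub_add_cancel_left, neg_div, abs_neg, abs_of_nonneg (by positivity)]

/-- The sum of the errors over the inputs with `k` ones. -/
noncomputable def levelErr (p : ℝ) (k : ℕ) : ℝ :=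
  ∑ S ∈ univ.powersetCard k, A.err (inputOf S) p

theorem progress_last_ge {p : ℝ} (hp : 1 / 2 < p) (hp1 : p ≤ 1) {k d : ℕ} (hd : 0 < d)
    (hkd : k + d ≤ n) :
    (2 * p - 1) ^ 2 / 4 * (pairCount n k d * (1 -
        (A.levelErr p k / n.choose k + A.levelErr p (k + d) / n.choose (k + d)) * (n / d))) ≤
      A.progress k d (Fin.last T) := by
  have hn : (0 : ℝ) < n := by exact_mod_cast (by omega : 0 < n)
  have hd' : (0 : ℝ) < d := by exact_mod_cast hd
  have hpair : ∀ S ∈ univ.powersetCard k, ∀ Z ∈ Sᶜ.powersetCard d,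
      (2 * p - 1) ^ 2 / 4 *
          (1 - (A.err (inputOf S) p + A.err (inputOf (S ∪ Z)) p) * (n / d)) ≤
        ‖A.state (inputOf S) (Fin.last T) - A.state (inputOf (S ∪ Z)) (Fin.last T)‖ ^ 2 := by
    intro S _ Z hZ
    have hdisj : Disjoint S Z :=
      disjoint_left.2 fun i hi hZ' => mem_compl.1 ((mem_powersetCard.1 hZ).1 hZ') hi
    have hm := mean_sub_mean_union hdisj
    rw [(mem_powersetCard.1 hZ).2] at hm
    have hne : mean (inputOf S) ≠ mean (inputOf (S ∪ Z)) := by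
      intro h
      rw [h, sub_self, abs_zero] at hm
      exact (div_pos hd' hn).ne hm
    have := A.le_norm_finalState_sub_sq _ _ hp hp1 hne
    rwa [hm, inv_div] at this
  refine le_trans (le_of_eq ?_) (sum_le_sum fun S hS => sum_le_sum fun Z hZ => hpair S hS Z hZ)
  simp only [← mul_sum, sum_sub_distrib, ← sum_mul, sum_add_distrib]
  -- Each `S` lies in equally many pairs, and so does each `R`; the pair averages of the errors are
  -- therefore level averages.
  have e0 : ∑ S ∈ (univ : Finset (Fin n)).powersetCard k, ∑ Z ∈ Sᶜ.powersetCard d, (1 : ℝ) =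
      pairCount n k d := by
    rw [sum_congr rfl (g := fun _ => ((n - k).choose d : ℝ))]
    · simp [pairCount]
    · intro S hS
      simp [card_compl, (mem_powersetCard.1 hS).2]
  have e1 : ∑ S ∈ (univ : Finset (Fin n)).powersetCard k, ∑ Z ∈ Sᶜ.powersetCard d,
      A.err (inputOf S) p = pairCount n k d * (A.levelErr p k / n.choose k) := by
    rw [sum_congr rfl (g := fun S => ((n - k).choose d : ℝ) * A.err (inputOf S) p)]
    · have : (n.choose k : ℝ) ≠ 0 := by exact_mod_cast (Nat.choose_pos (by omega)).ne'
      rw [← mul_sum, ← levelErr, pairCount]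
      push_cast
      field_simp
    · intro S hS
      simp [card_compl, (mem_powersetCard.1 hS).2]
  have e2 : ∑ S ∈ (univ : Finset (Fin n)).powersetCard k, ∑ Z ∈ Sᶜ.powersetCard d,
      A.err (inputOf (S ∪ Z)) p =
        pairCount n k d * (A.levelErr p (k + d) / n.choose (k + d)) := by
    rw [sum_powersetCard_compl_comm k d fun _ _ R => A.err (inputOf R) p,
      sum_congr rfl (g := fun R => ((k + d).choose d : ℝ) * A.err (inputOf R) p)]
    · have : (n.choose (k + d) : ℝ) ≠ 0 := by exact_mod_cast (Nat.choose_pos (by omega)).ne'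
      rw [← mul_sum, ← levelErr, pairCount_eq]
      push_cast
      field_simp
    · intro S hS
      simp [(mem_powersetCard.1 hS).2]
  rw [e0, e1, e2]
  ring

theorem sum_levelErr_le {p w : ℝ} (hp : 0 < p) {I : Finset ℕ}
    (hI : I ⊆ range (n + 1)) {μ : Measure (Input n)}
    (hμ : ∀ X : Input n, ones X ∈ I → w * (1 / (n.choose (ones X) : ℝ)) ≤ μ.real {X}) :
    w * ∑ k ∈ I, A.levelErr p k / n.choose k ≤ A.avgErr p μ := by
  have h0 : ∀ S : Finset (Fin n), 0 ≤ A.err (inputOf S) p * μ.real {inputOf S} :=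
    fun S => mul_nonneg (A.err_nonneg _ hp) measureReal_nonneg
  have h1 : A.avgErr p μ = ∑ k ∈ range (n + 1), ∑ S ∈ powersetCard k univ,
      A.err (inputOf S) p * μ.real {inputOf S} := by
    rw [avgErr, ← inputOf_bijective.sum_comp fun X : Input n => A.err X p * μ.real {X},
      ← powerset_univ, sum_powerset, card_univ, Fintype.card_fin]
  rw [h1, mul_sum]
  refine le_trans (sum_le_sum fun k hk => ?_)
    (sum_le_sum_of_subset_of_nonneg hI fun k _ _ => sum_nonneg fun S _ => h0 S)
  rw [levelErr, sum_div, mul_sum]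
  refine sum_le_sum fun S hS => ?_
  have hS' : ones (inputOf S) = k := (ones_inputOf S).trans (mem_powersetCard.1 hS).2
  have h := mul_le_mul_of_nonneg_left (hμ (inputOf S) (hS' ▸ hk)) (A.err_nonneg (inputOf S) hp)
  rw [hS'] at h
  exact le_of_eq_of_le (by ring) h

end QuantumAlgorithm

/-! ### Choice of the levels and the final bound -/

/-- A nonnegative function on an interval of length at least `2 d` takes values of the order of
its mean at two points with distance `d`. -/
theorem exists_add_le_four_mul {g : ℕ → ℝ} (hg : ∀ k, 0 ≤ g k) {a b d : ℕ} (hd : 0 < d)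
    (hcard : 2 * d ≤ (Icc a b).card) :
    ∃ k ∈ Icc a b, k + d ∈ Icc a b ∧
      g k + g (k + d) ≤ 4 * ((∑ k ∈ Icc a b, g k) / (Icc a b).card) := by
  rw [Nat.card_Icc] at *
  set G := ∑ k ∈ Icc a b, g k
  have hG : 0 ≤ G := sum_nonneg fun k _ => hg k
  have hne : (Icc a (b - d)).Nonempty := nonempty_Icc.2 (by omega)
  have h1 : ∑ k ∈ Icc a (b - d), g k ≤ G :=
    sum_le_sum_of_subset_of_nonneg (Icc_subset_Icc le_rfl (by omega)) fun k _ _ => hg k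
  have h2 : ∑ k ∈ Icc a (b - d), g (k + d) ≤ G := by
    refine (sum_map (Icc a (b - d)) (addRightEmbedding d) g).symm.trans_le ?_
    rw [map_add_right_Icc]
    exact sum_le_sum_of_subset_of_nonneg (Icc_subset_Icc (by omega) (by omega)) fun k _ _ => hg k
  -- At least half of the interval is available for `k`, and both shifted sums are at most `G`: the
  -- average is at most `2 G` over half the length.
  obtain ⟨k, hk, h⟩ := exists_le_of_sum_le hne
    (f := fun k => g k + g (k + d)) (g := fun _ => 4 * (G / (b + 1 - a : ℕ))) (by
      rw [sum_add_distrib, sum_const, nsmul_eq_mul, Nat.card_Icc]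
      refine (add_le_add h1 h2).trans ?_
      have hm : (0 : ℝ) < (b + 1 - a : ℕ) := by exact_mod_cast (by omega : 0 < b + 1 - a)
      have h3 : ((b + 1 - a : ℕ) : ℝ) ≤ 2 * (b - d + 1 - a : ℕ) := by
        exact_mod_cast (by omega : b + 1 - a ≤ 2 * (b - d + 1 - a))
      rw [← mul_div_assoc, ← mul_div_assoc, le_div_iff₀ hm]
      nlinarith)
  rw [mem_Icc] at hk
  exact ⟨k, mem_Icc.2 ⟨hk.1, by omega⟩, mem_Icc.2 ⟨by omega, by omega⟩, h⟩

namespace QuantumAlgorithm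

variable {n T : ℕ} (A : QuantumAlgorithm n T)

/-- The lower bound on the number of queries, for a fixed number of variables. -/
theorem le_queries {p c θ e : ℝ} (hp : 1 / 2 < p) (hp1 : p ≤ 1) (hc : 0 < c) (hθ : 0 < θ)
    (he : 0 < e) (hn : 0 < n) {a b : ℕ} (hb : b ≤ n) {μ : Measure (Input n)}
    (hk : ∀ k ∈ Icc a b, θ * (n : ℝ) ^ 2 ≤ (k : ℝ) * ((n : ℝ) - (k : ℝ)))
    (hμ : ∀ X : Input n, ones X ∈ Icc a b →
      c * ((Icc a b).card : ℝ)⁻¹ * (1 / (n.choose (ones X) : ℝ)) ≤ μ.real {X})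
    (hcard : 8 ≤ (Icc a b).card) (hsmall : e * n ≤ c / 32 * (Icc a b).card)
    (hA : A.avgErr p μ ≤ e) :
    (2 * p - 1) ^ 2 * θ / (32 * (8 / c + 1)) * min e⁻¹ (n : ℝ) ≤ T := by
  have hn' : (0 : ℝ) < n := by exact_mod_cast hn
  set m := (Icc a b).card with hm
  have hm8 : (8 : ℝ) ≤ m := by exact_mod_cast hcard
  -- The selected levels have error averages summing to at most `4 e / c`; the factor `8 / c` makes
  -- this at most half of the gap `d / n`.
  set x := 8 / c * (e * n) with hx
  have hx0 : 0 < x := by positivity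
  have hxm : x ≤ m / 4 := by
    have := mul_le_mul_of_nonneg_left hsmall (show 0 ≤ 8 / c by positivity)
    refine this.trans_eq ?_
    field_simp
    norm_num
  set d := ⌈x⌉₊ with hd
  have hd0 : 0 < d := Nat.ceil_pos.2 hx0
  have hd0' : (0 : ℝ) < d := by exact_mod_cast hd0
  have hxd : x ≤ d := Nat.le_ceil x
  have hdx : (d : ℝ) < x + 1 := Nat.ceil_lt_add_one hx0.le
  -- `d < m / 4 + 1`, and `8 ≤ m` absorbs the rounding.
  have h2d : 2 * d ≤ m := by
    have : (2 * d : ℝ) ≤ m := by linarith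
    exact_mod_cast this
  obtain ⟨k, hkI, hkdI, hkg⟩ := exists_add_le_four_mul
    (g := fun k => A.levelErr p k / n.choose k)
    (fun k => div_nonneg (sum_nonneg fun S _ => A.err_nonneg _ (by linarith)) (by positivity))
    hd0 h2d
  have hG := (A.sum_levelErr_le (by linarith) (fun k hk => by
    rw [mem_Icc] at hk
    exact mem_range.2 (by omega)) hμ).trans hA
  have hkn : k + d ≤ n := (mem_Icc.1 hkdI).2.trans hb
  have hmean : (A.levelErr p k / n.choose k + A.levelErr p (k + d) / n.choose (k + d)) *
      (n / d) ≤ 1 / 2 := by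
    have h1 : (∑ k ∈ Icc a b, A.levelErr p k / n.choose k) / m ≤ e / c := by
      rw [le_div_iff₀ hc]
      exact le_of_eq_of_le (by ring) hG
    have h2 : (A.levelErr p k / n.choose k + A.levelErr p (k + d) / n.choose (k + d)) ≤
      4 * (e / c) := hkg.trans (by linarith)
    refine (mul_le_mul_of_nonneg_right h2 (by positivity)).trans ?_
    rw [← mul_div_assoc, div_le_iff₀ hd0']
    refine le_trans (le_of_eq ?_) (mul_le_mul_of_nonneg_left hxd (by norm_num))
    rw [hx]
    ring
  have hlow := A.progress_last_ge hp hp1 hd0 hkn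
  have hup := A.progress_le (k := k) (d := d) (by omega) (by omega) (Fin.last T)
  rw [Fin.val_last] at hup
  have hkθ := hk k hkI
  have hkn' : (k : ℝ) ≤ n := by exact_mod_cast (by omega : k ≤ n)
  -- Both `k` and `n - k` are at most `n`, so their product being at least `θ n²` forces each to be
  -- at least `θ n`.
  have hk1 : θ * n ≤ (n - k : ℕ) := by
    rw [Nat.cast_sub (by omega)]
    nlinarith
  have hk2 : θ * n ≤ (k + d : ℕ) := by
    push_cast
    have hk0 : (0 : ℝ) ≤ k := Nat.cast_nonneg k
    nlinarith
  have hθn : 0 < θ * n := by positivity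
  have hfrac : (d : ℝ) / (n - k : ℕ) + d / (k + d : ℕ) ≤ 2 * (d / (θ * n)) := by
    rw [two_mul]
    gcongr
  have hN : (0 : ℝ) < pairCount n k d := by
    have : 0 < pairCount n k d :=
      Nat.mul_pos (Nat.choose_pos (by omega)) (Nat.choose_pos (by omega))
    exact_mod_cast this
  set q := (2 * p - 1) ^ 2 with hq
  have hq0 : 0 ≤ q := sq_nonneg _
  have hmain : q * (θ * n) ≤ 32 * d * T := by
    have h1 : q / 4 * (pairCount n k d * (1 / 2)) ≤
        T * (2 * pairCount n k d * (2 * (d / (θ * n)))) := by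
      refine le_trans ?_ (hlow.trans (hup.trans ?_))
      · gcongr
        linarith
      · gcongr
    have h2 : q / 8 ≤ T * (4 * (d / (θ * n))) := by
      refine le_of_mul_le_mul_left ?_ hN
      linarith
    rw [← mul_div_assoc, ← mul_div_assoc, le_div_iff₀ hθn] at h2
    linarith
  -- In `d < x + 1`, the part `x` is paid for by `e⁻¹` and the rounding `1` by `n`; this is the
  -- source of the minimum.
  have hmin : min e⁻¹ (n : ℝ) * d ≤ (8 / c + 1) * n := by
    have h0 : 0 ≤ min e⁻¹ (n : ℝ) := le_min (by positivity) hn'.le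
    have h1 : min e⁻¹ (n : ℝ) * x ≤ 8 / c * n := by
      refine (mul_le_mul_of_nonneg_right (min_le_left _ _) hx0.le).trans_eq ?_
      rw [hx]
      field_simp
    have h2 : min e⁻¹ (n : ℝ) * 1 ≤ n := by
      rw [mul_one]
      exact min_le_right _ _
    nlinarith
  have hc0 : 0 < 8 / c + 1 := by positivity
  rw [div_mul_eq_mul_div, div_le_iff₀ (by positivity)]
  refine le_of_mul_le_mul_right ?_ hd0'
  calc q * θ * min e⁻¹ (n : ℝ) * d = q * θ * (min e⁻¹ (n : ℝ) * d) := by ring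
    _ ≤ q * θ * ((8 / c + 1) * n) := by gcongr
    _ = (8 / c + 1) * (q * (θ * n)) := by ring
    _ ≤ (8 / c + 1) * (32 * d * T) := by gcongr
    _ = T * (32 * (8 / c + 1)) * d := by ring

end QuantumAlgorithm

end

end BooleanMean

theorem theorem3p1 (p : ℝ) (hp : 1 / 2 < p) (hp1 : p ≤ 1)
    (c θ : ℝ) (hc : 0 < c) (hθ : 0 < θ) :
    ∃ C : ℝ, 0 < C ∧
      ∀ (I : ℕ → Finset ℕ) (μ : ∀ n : ℕ, Measure (BooleanMean.Input n)) (ε : ℕ → ℝ),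
        -- `I n ⊆ {0, …, n}` consists of consecutive indices
        (∀ᶠ n : ℕ in atTop, ∃ a b : ℕ, b ≤ n ∧ I n = Finset.Icc a b) →
        Tendsto (fun n : ℕ => (I n).card) atTop atTop →
        -- `k (n - k) = Θ(n²)` on `I n`; the upper bound `k (n - k) ≤ n²` always holds
        (∀ᶠ n : ℕ in atTop, ∀ k ∈ I n, θ * (n : ℝ) ^ 2 ≤ (k : ℝ) * ((n : ℝ) - (k : ℝ))) →
        (∀ᶠ n : ℕ in atTop, IsProbabilityMeasure (μ n)) →
        (∀ᶠ n : ℕ in atTop, ∀ X : BooleanMean.Input n, BooleanMean.ones X ∈ I n →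
          c * ((I n).card : ℝ)⁻¹ * (1 / (n.choose (BooleanMean.ones X) : ℝ)) ≤ (μ n).real {X}) →
        (∀ᶠ n : ℕ in atTop, 0 < ε n) →
        (ε =o[atTop] fun n : ℕ => ((I n).card : ℝ) / (n : ℝ)) →
        ∀ᶠ n : ℕ in atTop, ∀ (T : ℕ) (A : BooleanMean.QuantumAlgorithm n T),
          A.avgErr p (μ n) ≤ ε n → C * min (ε n)⁻¹ (n : ℝ) ≤ (T : ℝ) := by
  have hq : 0 < (2 * p - 1) ^ 2 := pow_pos (by linarith) 2
  refine ⟨(2 * p - 1) ^ 2 * θ / (32 * (8 / c + 1)), by positivity, ?_⟩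
  intro I μ ε hI hcard hk _ hμ hε ho
  have ho' := ho.bound (show 0 < c / 32 by positivity)
  filter_upwards [hI, hcard.eventually_ge_atTop 8, hk, hμ, hε, ho', eventually_gt_atTop 0]
    with n hI hcard hk hμ hε ho hn T A hA
  obtain ⟨a, b, hb, hab⟩ := hI
  rw [hab] at hcard hk hμ ho
  have hn' : (0 : ℝ) < n := by exact_mod_cast hn
  refine A.le_queries hp hp1 hc hθ hε hn hb hk hμ hcard ?_ hA
  rw [Real.norm_of_nonneg hε.le, Real.norm_of_nonneg (by positivity), ← mul_div_assoc,
    le_div_iff₀ hn'] at ho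
  exact ho
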